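/- Let $A\in\mathbb R^{m\times d}$ have full rank $m\le d$, let $c\in\mathbb R^d$, $b\in\mathbb R^m$, and for $\tilde b\in\mathbb R^m$ let $\mathrm{OPT}(\tilde b)$ be the set of minimizers of $c^Tx$ over $\{x\in\mathbb R^d : Ax=\tilde b,\ x\ge 0\}$. A basis is a set $I\subseteq\{1,\dots,d\}$ of $m$ indices such that the matrix $A_I$ of the corresponding columns of $A$ is invertible; put $\lambda(I)=A_I^{-T}c_I\in\mathbb R^m$, and for $v\in\mathbb R^m$ let $x(I,v)\in\mathbb R^d$ be the vector that equals $A_I^{-1}v$ on the coordinates in $I$ and $0$ elsewhere. Let $I_1,\dots,I_K$ enumerate all bases $I$ with $\lambda(I)^TA\le c^T$ and $x(I,b)\ge 0$. Assume: * (A2) $\mathrm{OPT}(b)=\{x^\star(b)\}$ is a singleton. * (A3) $\lambda(I_j)\ne\lambda(I_k)$ for $1\le j<k\le K$. * (B1) $m_0\le m$, $r_n\to\infty$, and $b_n=(b_n^{m_0},b_{m_0+1},\dots,b_m)$, where $b_n^{m_0}$ is a random vector in $\mathbb R^{m_0}$ such that $r_n\bigl(b_n^{m_0}-(b_1,\dots,b_{m_0})\bigr)\xrightarrow{D}G^{m_0}$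 for some random vector $G^{m_0}$ in $\mathbb R^{m_0}$, which need not be absolutely continuous. Put $G=(G^{m_0},0)\in\mathbb R^m$. * (B2) $\mathbb P(\mathrm{OPT}(b_n)\ne\emptyset)\to 1$. For $k\le K$ let $$H_k=\bigl\{v\in\mathbb R^{m_0} : x_i\bigl(I_k,(v,0)\bigr)\ge 0\ \text{ for all } i\in I_k \text{ with } x^\star_i(b)=0\bigr\}.$$ Let $x^\star(b_n)$ be any measurable choice of an empirical optimal solution, that is, random vectors in $\mathbb R^d$ with $x^\star(b_n)\in\mathrm{OPT}(b_n)$ almost surely on the event $\{\mathrm{OPT}(b_n)\ne\emptyset\}$ (and with arbitrary values elsewhere). Then, as $n\to\infty$, $$r_n\bigl(x^\star(b_n)-x^\star(b)\bigr)\xrightarrow{D}\sum_{k=1}^K\mathbf 1\Bigl\{G^{m_0}\in H_k\setminus\bigcup_{j<k}H_j\Bigr\}\,x(I_k,G).$$ -/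

import Mathlib

open MeasureTheory Filter Topology
open scoped Matrix

noncomputable section

namespace StochLP

variable {m d : ℕ}

/-- The feasible set `{x ∈ ℝ^d | A x = b, x ≥ 0}` of the primal linear program. -/
def feasibleSet (A : Matrix (Fin m) (Fin d) ℝ) (b : Fin m → ℝ) : Set (Fin d → ℝ) :=
  {x | A *ᵥ x = b ∧ 0 ≤ x}

/-- The set of minimizers of `cᵀ x` over the feasible set. -/
def optSet (A : Matrix (Fin m) (Fin d) ℝ) (c : Fin d → ℝ) (b : Fin m → ℝ) : Set (Fin d → ℝ) :=
  {x | x ∈ feasibleSet A b ∧ ∀ y ∈ feasibleSet A b, c ⬝ᵥ x ≤ c ⬝ᵥ y}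

/-- A basis: a set of `m` column indices whose columns form an invertible `m × m` matrix
(the columns being taken in increasing order of their indices). -/
structure LPBasis (A : Matrix (Fin m) (Fin d) ℝ) where
  idx : Finset (Fin d)
  card_idx : idx.card = m
  isUnit : IsUnit (A.submatrix id (idx.orderEmbOfFin card_idx))

namespace LPBasis

variable {A : Matrix (Fin m) (Fin d) ℝ}

/-- The increasing enumeration of the indices of a basis. -/
def enum (I : LPBasis A) : Fin m ↪o Fin d :=
  I.idx.orderEmbOfFin I.card_idx

/-- The square matrix `A_I` of the columns indexed by `I`. -/
def mat (I : LPBasis A) : Matrix (Fin m) (Fin m) ℝ :=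
  A.submatrix id I.enum

/-- The dual basic solution `λ(I) = A_I^{-T} c_I`. -/
def dualSol (I : LPBasis A) (c : Fin d → ℝ) : Fin m → ℝ :=
  (I.mat)ᵀ⁻¹ *ᵥ (fun j => c (I.enum j))

/-- The operator `Aug_I`, which puts a vector of `ℝ^m` in the coordinates indexed by `I` and
zeros elsewhere. -/
def aug (I : LPBasis A) (u : Fin m → ℝ) : Fin d → ℝ :=
  Function.extend I.enum u 0

/-- The primal basic solution `x(I, b) = Aug_I (A_I^{-1} b)`. -/
def primalSol (I : LPBasis A) (b : Fin m → ℝ) : Fin d → ℝ :=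
  I.aug ((I.mat)⁻¹ *ᵥ b)

/-- `I` is dual feasible: `λ(I)ᵀ A ≤ cᵀ`. -/
def DualFeasible (I : LPBasis A) (c : Fin d → ℝ) : Prop :=
  I.dualSol c ᵥ* A ≤ c

/-- `I` is primal feasible for the right-hand side `b`: `x(I, b) ≥ 0`. -/
def PrimalFeasible (I : LPBasis A) (b : Fin m → ℝ) : Prop :=
  0 ≤ I.primalSol b

end LPBasis

/-- The first `m₀` coordinates of a vector. -/
def head {m₀ : ℕ} (h : m₀ ≤ m) (b : Fin m → ℝ) : Fin m₀ → ℝ :=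
  fun j => b (Fin.castLE h j)

/-- The vector whose first `m₀` coordinates are those of `u` and whose other coordinates are
those of `b`. For `b = 0` this is `u` padded with zeros. -/
def glue {m₀ : ℕ} (u : Fin m₀ → ℝ) (b : Fin m → ℝ) : Fin m → ℝ :=
  fun i => if h : i.1 < m₀ then u ⟨i.1, h⟩ else b i

/-- The cone in `ℝ^{m₀}` of all `v` such that the coordinates of `x(I, (v, 0))` with index
in `I` outside the support of `xstar` are nonnegative. -/
def cone {A : Matrix (Fin m) (Fin d) ℝ} (m₀ : ℕ) (I : LPBasis A) (xstar : Fin d → ℝ) :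
    Set (Fin m₀ → ℝ) :=
  {v | ∀ i ∈ I.idx, xstar i = 0 → 0 ≤ I.primalSol (glue v 0) i}

end StochLP

end

/-! By (A2) and (A3), every optimal basis has positive reduced costs off the basis. If one vanished,
pivoting that index in would give a second optimal basis with the same dual solution
(`exists_ne_dualSol_eq`); uniqueness of the optimum is what makes the pivot possible. Hence whenever
`I k` is feasible for a right-hand side, its basic solution is the only optimum there
(`optSet_eq_singleton`).

Put v_n = r_n (b_n^{m₀} - head b), so that b_n = b + (v_n, 0) / r_n. If b_n is close to b and the
program is solvable, the fundamental theorem supplies an optimal basis for b_n. This basis is also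
feasible for b, hence is some `I k`. Linearity of x(I_k, ·) then gives v_n ∈ H_k and r_n (x*(b_n) -
x*(b)) = x(I_k, (v_n, 0)) exactly.

On overlaps of the cones the basic solutions agree (`primalSol_eq_of_mem_cone`), so the order of
priority is immaterial there and the pieces paste to a map continuous on the closed union of the
cones. A continuous mapping theorem relative to that closed set finishes the proof. No boundary
needs to be negligible for the limit, so absolute continuity plays no role. -/

/-! ### Finitely generated cones: Carathéodory and Farkas. -/

section ConicCombinations

variable {ι E : Type*} [Fintype ι]

/-- **Carathéodory's theorem for cones**: a conic combination of finitely many vectors can be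
rewritten so that only linearly independent vectors occur. -/
theorem exists_conic_combination_linearIndepOn [AddCommGroup E] [Module ℝ E] (v : ι → E)
    {x : ι → ℝ} (hx : 0 ≤ x) :
    ∃ y : ι → ℝ, 0 ≤ y ∧ ∑ i, y i • v i = ∑ i, x i • v i ∧ (∀ i, x i = 0 → y i = 0) ∧
      LinearIndepOn ℝ v {i | y i ≠ 0} := by
  classical
  induction hn : (Finset.univ.filter fun i => x i ≠ 0).card using Nat.strong_induction_on
    generalizing x with
  | _ n ih =>
  by_cases hli : LinearIndepOn ℝ v {i | x i ≠ 0}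
  · exact ⟨x, hx, rfl, fun _ h => h, hli⟩
  have hcoe : {i | x i ≠ 0} = ((Finset.univ.filter fun i => x i ≠ 0 : Finset ι) : Set ι) := by
    ext; simp
  rw [hcoe, linearIndepOn_finset_iff] at hli
  push Not at hli
  obtain ⟨g₀, hg₀, i₀, hi₀, hgi₀⟩ := hli
  -- A linear relation on the support of `x`, with its sign chosen so that some coefficient is
  -- positive.
  obtain ⟨g, hg, hgx, i₁, hi₁⟩ : ∃ g : ι → ℝ, ∑ i, g i • v i = 0 ∧ (∀ i, x i = 0 → g i = 0) ∧
      ∃ i, 0 < g i := by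
    let g₁ : ι → ℝ := fun i => if x i = 0 then 0 else g₀ i
    have h₁ : ∑ i, g₁ i • v i = 0 := by
      rw [← hg₀, Finset.sum_filter]
      refine Finset.sum_congr rfl fun i _ => ?_
      by_cases h : x i = 0 <;> simp [g₁, h]
    have h₂ : g₁ i₀ ≠ 0 := by
      have : x i₀ ≠ 0 := by simpa using hi₀
      simpa [g₁, this] using hgi₀
    rcases lt_or_gt_of_ne h₂ with h | h
    · refine ⟨-g₁, by simp [h₁], fun i hi => by simp [g₁, hi], i₀, by simpa using h⟩
    · exact ⟨g₁, h₁, fun i hi => by simp [g₁, hi], i₀, h⟩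
  -- The largest multiple of `g` that can be subtracted while keeping nonnegativity; it kills
  -- coordinate `k` and so shrinks the support.
  obtain ⟨k, hk, hkmin⟩ := Finset.exists_min_image (Finset.univ.filter fun i => 0 < g i)
    (fun i => x i / g i) ⟨i₁, by simpa using hi₁⟩
  have hgk : 0 < g k := by simpa using hk
  let t := x k / g k
  have ht : 0 ≤ t := div_nonneg (hx k) hgk.le
  have hxk : x k ≠ 0 := fun h => hgk.ne' (hgx k h)
  let x' : ι → ℝ := fun i => x i - t * g i
  have hx'k : x' k = 0 := by simp [x', t, hgk.ne']
  have hx'0 : ∀ i, x i = 0 → x' i = 0 := fun i hi => by simp [x', hi, hgx i hi]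
  have hx' : 0 ≤ x' := by
    intro i
    simp only [x', Pi.zero_apply, sub_nonneg]
    rcases le_or_gt (g i) 0 with h | h
    · exact (mul_nonpos_of_nonneg_of_nonpos ht h).trans (hx i)
    · have := hkmin i (by simpa using h)
      exact (le_div_iff₀ h).1 this
  have hcard : (Finset.univ.filter fun i => x' i ≠ 0).card < n := by
    rw [← hn]
    refine Finset.card_lt_card ((Finset.ssubset_iff_of_subset ?_).2 ⟨k, by simpa using hxk, ?_⟩)
    · intro i hi
      simp only [Finset.mem_filter, Finset.mem_univ, true_and] at hi ⊢
      exact fun h => hi (hx'0 i h)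
    · simpa using hx'k
  obtain ⟨y, hy, hsum, hyx, hyli⟩ := ih _ hcard hx' rfl
  refine ⟨y, hy, ?_, fun i hi => hyx i (hx'0 i hi), hyli⟩
  rw [hsum]
  simp only [x', sub_smul, Finset.sum_sub_distrib, mul_smul, ← Finset.smul_sum, hg, smul_zero,
    sub_zero]

variable [NormedAddCommGroup E] [NormedSpace ℝ E]

/-- A finitely generated cone is closed. -/
theorem isClosed_setOf_conic_combination (v : ι → E) :
    IsClosed {z : E | ∃ x : ι → ℝ, 0 ≤ x ∧ ∑ i, x i • v i = z} := by
  classical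
  have hsum_coe (S : Set ι) (f : ι → E) (hf : ∀ i, i ∉ S → f i = 0) :
      ∑ i : S, f i = ∑ i, f i := by
    rw [← Finset.sum_subtype (Finset.univ.filter (· ∈ S)) (by simp) f]
    exact Finset.sum_filter_of_ne fun i _ hi => by_contra fun h => hi (hf i h)
  -- By Carathéodory the cone is a finite union of images of orthants under injective linear maps,
  -- which are closed embeddings since their domains are finite-dimensional.
  have key : {z : E | ∃ x : ι → ℝ, 0 ≤ x ∧ ∑ i, x i • v i = z} =
      ⋃ S ∈ {S : Set ι | LinearIndepOn ℝ v S},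
        (Fintype.linearCombination ℝ (fun i : S => v i)) '' {x | 0 ≤ x} := by
    ext z
    simp only [Set.mem_ofPred_eq, Set.mem_iUnion, Set.mem_image, exists_prop]
    constructor
    · rintro ⟨x, hx, rfl⟩
      obtain ⟨y, hy, hsum, -, hli⟩ := exists_conic_combination_linearIndepOn v hx
      refine ⟨_, hli, fun i => y i, fun i => hy i, ?_⟩
      rw [← hsum, Fintype.linearCombination_apply]
      exact hsum_coe _ (fun i => y i • v i) fun i hi => by
        have : y i = 0 := by simpa using hi
        simp [this]
    · rintro ⟨S, -, x, hx, rfl⟩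
      refine ⟨fun i => if h : i ∈ S then x ⟨i, h⟩ else 0, fun i => ?_, ?_⟩
      · by_cases h : i ∈ S <;> simp [h]
        exact hx _
      · rw [Fintype.linearCombination_apply]
        rw [← hsum_coe S _ fun i hi => by simp [hi]]
        exact Finset.sum_congr rfl fun i _ => by simp
  rw [key]
  refine Set.Finite.isClosed_biUnion (Set.toFinite _) fun S hS => ?_
  have hinj : Function.Injective (Fintype.linearCombination ℝ (fun i : S => v i)) := 
    linearIndependent_iff_injective_fintypeLinearCombination.1 hS
  exact (LinearMap.isClosedEmbedding_of_injective (LinearMap.ker_eq_bot.2 hinj)).isClosedMap _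
    isClosed_Ici

/-- **Farkas' lemma**. -/
theorem exists_conic_combination_of_forall_dual (v : ι → E) (z : E)
    (h : ∀ f : E →ₗ[ℝ] ℝ, (∀ i, 0 ≤ f (v i)) → 0 ≤ f z) :
    ∃ x : ι → ℝ, 0 ≤ x ∧ ∑ i, x i • v i = z := by
  classical
  by_contra hz
  let C : ProperCone ℝ E :=
    { carrier := {z : E | ∃ x : ι → ℝ, 0 ≤ x ∧ ∑ i, x i • v i = z}
      add_mem' := by
        rintro _ _ ⟨x, hx, rfl⟩ ⟨y, hy, rfl⟩
        exact ⟨x + y, add_nonneg hx hy, by simp [add_smul, Finset.sum_add_distrib]⟩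
      zero_mem' := ⟨0, le_rfl, by simp⟩
      smul_mem' := by
        rintro r _ ⟨x, hx, rfl⟩
        refine ⟨(r : ℝ) • x, smul_nonneg r.2 hx, ?_⟩
        simp [mul_smul, Finset.smul_sum]
      isClosed' := isClosed_setOf_conic_combination v }
  obtain ⟨f, hf, hfz⟩ := C.hyperplane_separation_point (x₀ := z) hz
  refine hfz.not_ge (h f fun i => hf _ ⟨Pi.single i 1, ?_, ?_⟩)
  · exact Pi.single_nonneg.2 zero_le_one
  · simp [Pi.single_apply]

end ConicCombinations

/-! ### Bases, strong duality and the fundamental theorem. -/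

namespace StochLP

variable {m d : ℕ}

theorem vecMul_injective_of_rank_eq {A : Matrix (Fin m) (Fin d) ℝ} (hA : A.rank = m) :
    Function.Injective (fun w : Fin m → ℝ => w ᵥ* A) := by
  have h : LinearMap.ker Aᵀ.mulVecLin = ⊥ := by
    apply Submodule.finrank_eq_zero.1
    have h₁ := Aᵀ.mulVecLin.finrank_range_add_finrank_ker
    have h₂ : Module.finrank ℝ (LinearMap.range Aᵀ.mulVecLin) = m :=
      (Matrix.rank_transpose A).trans hA
    simp only [Module.finrank_fin_fun] at h₁
    omega
  intro w w' hw
  apply LinearMap.ker_eq_bot.1 h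
  simpa [Matrix.mulVec_transpose] using hw

/-- Positive coordinates of `x` absorb any small step, so only its zero coordinates constrain the
direction `y`. This makes directions feasible both in the duality proof and on overlaps of cones. -/
theorem eventually_forall_nonneg_add_mul {ι : Type*} [Finite ι] {x y : ι → ℝ} (hx : 0 ≤ x)
    (hy : ∀ i, x i = 0 → 0 ≤ y i) : ∀ᶠ ε in 𝓝[>] (0 : ℝ), ∀ i, 0 ≤ x i + ε * y i := by
  refine eventually_all.2 fun i => ?_
  rcases (hx i).eq_or_lt with h0 | hpos
  · filter_upwards [self_mem_nhdsWithin] with ε hε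
    have h0' : x i = 0 := h0.symm
    simpa [h0'] using mul_nonneg (le_of_lt hε) (hy i h0')
  · refine Filter.Eventually.filter_mono nhdsWithin_le_nhds ?_
    have : Tendsto (fun ε : ℝ => x i + ε * y i) (𝓝 0) (𝓝 (x i + 0 * y i)) :=
      (by fun_prop : Continuous fun ε : ℝ => x i + ε * y i).tendsto 0
    rw [zero_mul, add_zero] at this
    exact (this.eventually (lt_mem_nhds hpos)).mono fun _ h => h.le

namespace LPBasis

variable {A : Matrix (Fin m) (Fin d) ℝ}

/-- A set of `m` columns without nontrivial relation is a basis. -/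
def ofKernelTrivial (S : Finset (Fin d)) (hS : S.card = m)
    (h : ∀ g : Fin d → ℝ, (∀ j, j ∉ S → g j = 0) → A *ᵥ g = 0 → g = 0) : LPBasis A where
  idx := S
  card_idx := hS
  isUnit := by
    rw [← Matrix.mulVec_injective_iff_isUnit]
    refine (injective_iff_map_eq_zero (Matrix.mulVecLin _)).2 fun u hu => ?_
    have hinj : Function.Injective (S.orderEmbOfFin hS) := (S.orderEmbOfFin hS).injective
    have h₀ := h (Function.extend (S.orderEmbOfFin hS) u 0) (fun j hj => ?_) ?_
    · ext k
      simpa [hinj.extend_apply] using congrFun h₀ (S.orderEmbOfFin hS k)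
    · rw [Function.extend_apply']
      · rfl
      · rintro ⟨k, rfl⟩
        exact hj (S.orderEmbOfFin_mem hS k)
    · rw [← hu]
      ext i
      simp only [Matrix.mulVecLin_apply, Matrix.mulVec, dotProduct, Matrix.submatrix_apply, id]
      refine (Finset.sum_of_injOn (S.orderEmbOfFin hS) hinj.injOn (by simp) (fun j _ hj => ?_)
        (fun k _ => by rw [hinj.extend_apply])).symm
      rw [Function.extend_apply', Pi.zero_apply, mul_zero]
      simpa only [Finset.coe_univ, Set.image_univ, Set.mem_range] using hj

variable (I : LPBasis A)

theorem idx_injective : Function.Injective (idx : LPBasis A → Finset (Fin d)) := by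
  rintro ⟨S, _, _⟩ ⟨T, _, _⟩ rfl
  rfl

instance : Finite (LPBasis A) := Finite.of_injective _ idx_injective

theorem enum_mem (k : Fin m) : I.enum k ∈ I.idx := I.idx.orderEmbOfFin_mem I.card_idx k

theorem exists_enum_eq {j : Fin d} (hj : j ∈ I.idx) : ∃ k, I.enum k = j := by
  have := I.idx.range_orderEmbOfFin I.card_idx
  exact (this ▸ hj : j ∈ Set.range (I.idx.orderEmbOfFin I.card_idx))

theorem aug_enum (u : Fin m → ℝ) (k : Fin m) : I.aug u (I.enum k) = u k :=
  I.enum.injective.extend_apply _ _ _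

theorem aug_of_notMem (u : Fin m → ℝ) {j : Fin d} (hj : j ∉ I.idx) : I.aug u j = 0 := by
  refine Function.extend_apply' _ _ _ ?_
  rintro ⟨k, rfl⟩
  exact hj (I.enum_mem k)

theorem primalSol_of_notMem (v : Fin m → ℝ) {j : Fin d} (hj : j ∉ I.idx) : I.primalSol v j = 0 :=
  I.aug_of_notMem _ hj

theorem aug_comp_enum {y : Fin d → ℝ} (hy : ∀ j, j ∉ I.idx → y j = 0) :
    I.aug (fun k => y (I.enum k)) = y := by
  ext j
  by_cases hj : j ∈ I.idx
  · obtain ⟨k, rfl⟩ := I.exists_enum_eq hj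
    exact I.aug_enum _ k
  · rw [I.aug_of_notMem _ hj, hy j hj]

theorem mulVec_aug (u : Fin m → ℝ) : A *ᵥ I.aug u = I.mat *ᵥ u := by
  ext i
  simp only [Matrix.mulVec, dotProduct, mat, Matrix.submatrix_apply, id]
  refine (Finset.sum_of_injOn I.enum I.enum.injective.injOn (by simp) (fun j _ hj => ?_)
    (fun k _ => by rw [aug_enum])).symm
  rw [I.aug_of_notMem, mul_zero]
  exact fun h => hj (by simpa using I.exists_enum_eq h)

theorem isUnit_det_mat : IsUnit I.mat.det := (Matrix.isUnit_iff_isUnit_det _).1 I.isUnit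

theorem mulVec_primalSol (v : Fin m → ℝ) : A *ᵥ I.primalSol v = v := by
  rw [primalSol, mulVec_aug, Matrix.mulVec_mulVec, Matrix.mul_nonsing_inv _ I.isUnit_det_mat,
    Matrix.one_mulVec]

/-- `A` is injective on vectors supported in the basis, so such vectors are identified by their
image under `A`. -/
theorem eq_primalSol {y : Fin d → ℝ} (hy : ∀ j, j ∉ I.idx → y j = 0) :
    y = I.primalSol (A *ᵥ y) := by
  conv_rhs => rw [← I.aug_comp_enum hy, mulVec_aug, primalSol, Matrix.mulVec_mulVec,
    Matrix.nonsing_inv_mul _ I.isUnit_det_mat, Matrix.one_mulVec, I.aug_comp_enum hy]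

theorem primalSol_add_smul (v w : Fin m → ℝ) (t : ℝ) :
    I.primalSol (v + t • w) = I.primalSol v + t • I.primalSol w := by
  have h := I.eq_primalSol (y := I.primalSol v + t • I.primalSol w) fun j hj => by
    simp [I.primalSol_of_notMem _ hj]
  rw [h, Matrix.mulVec_add, Matrix.mulVec_smul, mulVec_primalSol, mulVec_primalSol]

theorem continuous_primalSol : Continuous I.primalSol := by
  refine continuous_pi fun j => ?_
  by_cases hj : j ∈ I.idx
  · obtain ⟨k, rfl⟩ := I.exists_enum_eq hj
    simp only [primalSol, aug_enum]
    exact (continuous_apply k).comp (Continuous.matrix_mulVec continuous_const continuous_id)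
  · simp only [I.primalSol_of_notMem _ hj]
    exact continuous_const

theorem dualSol_vecMul_of_mem (c : Fin d → ℝ) {j : Fin d} (hj : j ∈ I.idx) :
    (I.dualSol c ᵥ* A) j = c j := by
  obtain ⟨k, rfl⟩ := I.exists_enum_eq hj
  have h : I.dualSol c ᵥ* I.mat = fun k => c (I.enum k) := by
    rw [← Matrix.mulVec_transpose, dualSol, Matrix.mulVec_mulVec, Matrix.mul_nonsing_inv,
      Matrix.one_mulVec]
    rw [Matrix.det_transpose]
    exact I.isUnit_det_mat
  exact congrFun h k

theorem eq_dualSol {c : Fin d → ℝ} {w : Fin m → ℝ} (hw : ∀ j ∈ I.idx, (w ᵥ* A) j = c j) :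
    w = I.dualSol c := by
  have h : I.matᵀ *ᵥ w = fun k => c (I.enum k) := by
    ext k
    rw [Matrix.mulVec_transpose]
    exact hw _ (I.enum_mem k)
  rw [dualSol, ← h, Matrix.mulVec_mulVec, Matrix.nonsing_inv_mul, Matrix.one_mulVec]
  rw [Matrix.det_transpose]
  exact I.isUnit_det_mat

/-- The cost of a point is the dual value of its right-hand side plus the reduced cost. -/
theorem dotProduct_eq_add_reduced (c y : Fin d → ℝ) :
    c ⬝ᵥ y = I.dualSol c ⬝ᵥ (A *ᵥ y) + (c - I.dualSol c ᵥ* A) ⬝ᵥ y := by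
  rw [sub_dotProduct, Matrix.dotProduct_mulVec]
  ring

theorem reduced_dotProduct_primalSol (c : Fin d → ℝ) (v : Fin m → ℝ) :
    (c - I.dualSol c ᵥ* A) ⬝ᵥ I.primalSol v = 0 := by
  refine Finset.sum_eq_zero fun j _ => ?_
  by_cases hj : j ∈ I.idx
  · simp [I.dualSol_vecMul_of_mem c hj]
  · simp [I.primalSol_of_notMem v hj]

variable {I}

theorem primalSol_mem_optSet {c : Fin d → ℝ} {v : Fin m → ℝ} (hd : I.DualFeasible c)
    (hp : I.PrimalFeasible v) : I.primalSol v ∈ optSet A c v := by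
  refine ⟨⟨I.mulVec_primalSol v, hp⟩, fun y hy => ?_⟩
  rw [I.dotProduct_eq_add_reduced c y, I.dotProduct_eq_add_reduced c (I.primalSol v), hy.1,
    mulVec_primalSol, reduced_dotProduct_primalSol]
  have : 0 ≤ (c - I.dualSol c ᵥ* A) ⬝ᵥ y := dotProduct_nonneg_of_nonneg (sub_nonneg.2 hd) hy.2
  linarith

end LPBasis

variable {A : Matrix (Fin m) (Fin d) ℝ}

/-- **Strong duality** with complementary slackness, at a vertex of the dual polyhedron: the
columns whose dual constraint is tight span `ℝ^m`. -/
theorem exists_dual_vertex (hA : A.rank = m) {c : Fin d → ℝ} {v : Fin m → ℝ} {x : Fin d → ℝ}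
    (hx : x ∈ optSet A c v) :
    ∃ (w : Fin m → ℝ) (s : Fin d → ℝ), 0 ≤ s ∧ w ᵥ* A + s = c ∧ (∀ j, s j ≠ 0 → x j = 0) ∧
      ∀ u : Fin m → ℝ, (∀ j, s j = 0 → (u ᵥ* A) j = 0) → u = 0 := by
  classical
  -- Modulo the row space, a dual point with slack `s` is a conic representation of the class of `c`
  -- by classes of unit vectors. Replacing generators by zero where `x j ≠ 0` enforces complementary
  -- slackness.
  let R : Submodule ℝ (Fin d → ℝ) := LinearMap.range A.vecMulLinear
  have : IsClosed (R : Set (Fin d → ℝ)) := R.closed_of_finiteDimensional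
  let g : Fin d → (Fin d → ℝ) ⧸ R := fun j => if x j = 0 then R.mkQ (Pi.single j 1) else 0
  have hrow : ∀ u : Fin m → ℝ, R.mkQ (u ᵥ* A) = 0 := fun u =>
    (Submodule.Quotient.mk_eq_zero R).2 ⟨u, rfl⟩
  have hexp : ∀ u : Fin d → ℝ, R.mkQ u = ∑ j, u j • R.mkQ (Pi.single j 1) := fun u => by
    conv_lhs => rw [pi_eq_sum_univ' u]
    simp only [map_sum, map_smul]
  -- A functional on the quotient is a vector `y` in the kernel of `A`. Nonnegativity on the
  -- generators makes `x + ε • y` feasible for small `ε`, and optimality of `x` gives `0 ≤ c ⬝ᵥ y`.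
  obtain ⟨s₀, hs₀, hsum₀⟩ := exists_conic_combination_of_forall_dual g (R.mkQ c) fun f hf => by
    let y : Fin d → ℝ := fun j => f (R.mkQ (Pi.single j 1))
    have hfy : ∀ u : Fin d → ℝ, f (R.mkQ u) = u ⬝ᵥ y := fun u => by
      rw [hexp u]
      simp [dotProduct, y]
    have hAy : A *ᵥ y = 0 := by
      refine dotProduct_eq_zero _ fun u => ?_
      rw [dotProduct_comm, Matrix.dotProduct_mulVec, ← hfy, hrow, map_zero]
    have hev := eventually_forall_nonneg_add_mul (y := y) hx.1.2 fun j hj => by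
      have h := hf j
      rwa [show g j = R.mkQ (Pi.single j 1) from if_pos hj] at h
    obtain ⟨ε, hεy, hε⟩ := (hev.and self_mem_nhdsWithin).exists
    have hopt := hx.2 (x + ε • y)
      ⟨by rw [Matrix.mulVec_add, Matrix.mulVec_smul, hAy, smul_zero, add_zero, hx.1.1], hεy⟩
    rw [dotProduct_add, dotProduct_smul, smul_eq_mul, le_add_iff_nonneg_right] at hopt
    rw [hfy]
    exact nonneg_of_mul_nonneg_right hopt hε
  -- Independence of the support of `s` modulo the row space is the vertex property: a row
  -- combination supported there is a relation, hence zero.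
  obtain ⟨s, hs, hsum, -, hli⟩ := exists_conic_combination_linearIndepOn g hs₀
  have hsx : ∀ j, s j ≠ 0 → x j = 0 := fun j hj => by
    by_contra h
    exact hli.ne_zero hj (by simp [g, h])
  have hg : ∀ u : Fin d → ℝ, (∀ j, s j = 0 → u j = 0) → R.mkQ u = ∑ j, u j • g j := fun u hu => by
    rw [hexp u]
    refine Finset.sum_congr rfl fun j _ => ?_
    by_cases hj : s j = 0
    · simp [hu j hj]
    · simp [g, hsx j hj]
  have hcs : R.mkQ (c - s) = 0 := by
    rw [map_sub, hg s fun _ h => h, hsum, hsum₀, sub_self]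
  obtain ⟨w, hw⟩ := (Submodule.Quotient.mk_eq_zero R).1 hcs
  refine ⟨w, s, hs, ?_, hsx, fun u hu => ?_⟩
  · have : w ᵥ* A = c - s := hw
    rw [this, sub_add_cancel]
  · have h₀ : ∑ j, (u ᵥ* A) j • g j = 0 := by rw [← hg _ hu, hrow]
    have hcoe : {j | s j ≠ 0} = ((Finset.univ.filter fun j => s j ≠ 0 : Finset _) : Set _) := by
      ext; simp
    rw [hcoe, linearIndepOn_finset_iff] at hli
    have h₁ := hli (u ᵥ* A) (by
      rw [← h₀]
      refine Finset.sum_filter_of_ne fun j _ hj hsj => hj ?_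
      rw [hu j hsj, zero_smul])
    apply vecMul_injective_of_rank_eq hA
    ext j
    by_cases hj : s j = 0
    · simpa using hu j hj
    · simpa using h₁ j (by simpa using hj)

/-- **Fundamental theorem of linear programming**: a solvable program has a basis that is both
primal and dual feasible. -/
theorem exists_dualFeasible_primalFeasible (hA : A.rank = m) {c : Fin d → ℝ} {v : Fin m → ℝ}
    (hv : (optSet A c v).Nonempty) :
    ∃ I : LPBasis A, I.DualFeasible c ∧ I.PrimalFeasible v := by
  classical
  obtain ⟨x, hx⟩ := hv
  obtain ⟨w, s, hs, hws, hsx, hspan⟩ := exists_dual_vertex hA hx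
  have hmul : ∀ y : Fin d → ℝ, A *ᵥ y = ∑ j, y j • Aᵀ j := fun y => by
    ext i
    simp [Matrix.mulVec, dotProduct, mul_comm]
  obtain ⟨y, hy, hysum, hyx, hyli⟩ := exists_conic_combination_linearIndepOn (fun j => Aᵀ j) hx.1.2
  rw [← hmul, ← hmul, hx.1.1] at hysum
  -- The support of the basic point `y` is extended inside the tight columns: tightness will give
  -- dual feasibility, containing the support of `y` primal feasibility.
  obtain ⟨B, hBT, hyB, hTB, hB⟩ := exists_linearIndepOn_extension (t := {j | s j = 0}) hyli
    fun j hj => by_contra fun h => hj (hyx j (hsx j h))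
  -- A functional vanishing on the span of `B` kills every tight column, so the vertex property
  -- makes it zero.
  have htop : Submodule.span ℝ ((fun j => Aᵀ j) '' B) = ⊤ := by
    by_contra hne
    obtain ⟨f, hf, hle⟩ := Submodule.exists_le_ker_of_lt_top _ (lt_top_iff_ne_top.2 hne)
    let u : Fin m → ℝ := fun i => f (Pi.single i 1)
    have hfu : ∀ z : Fin m → ℝ, f z = u ⬝ᵥ z := fun z => by
      rw [LinearMap.pi_apply_eq_sum_univ f z]
      refine Finset.sum_congr rfl fun i _ => ?_
      rw [smul_eq_mul, mul_comm]
      congr 2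
      ext k
      simp [Pi.single_apply, eq_comm]
    have hu : u = 0 := hspan u fun j hj => by
      have : f (Aᵀ j) = 0 := hle (hTB ⟨j, hj, rfl⟩)
      rw [← this, hfu]
      rfl
    exact hf (LinearMap.ext fun z => by simp [hfu, hu])
  have hcard : B.toFinset.card = m := by
    have h₁ := finrank_span_eq_card hB
    rw [← Set.image_eq_range (fun j => Aᵀ j) B, htop, finrank_top, Module.finrank_fin_fun] at h₁
    rw [Set.toFinset_card, h₁]
  let I : LPBasis A := LPBasis.ofKernelTrivial B.toFinset hcard fun g hg hAg => by
    have hB' : LinearIndepOn ℝ (fun j => Aᵀ j) (B.toFinset : Set (Fin d)) := by simpa using hB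
    rw [linearIndepOn_finset_iff] at hB'
    have h₁ := hB' g (by
      rw [← hAg, hmul]
      exact Finset.sum_subset (Finset.subset_univ _) fun j _ hj => by rw [hg j hj, zero_smul])
    ext j
    by_cases hj : j ∈ B.toFinset
    · exact h₁ j hj
    · exact hg j hj
  have hmem : ∀ j, j ∈ I.idx ↔ j ∈ B := fun j => Set.mem_toFinset
  have hw : w = I.dualSol c := I.eq_dualSol fun j hj => by
    have := hBT ((hmem j).1 hj)
    simp [← hws, show s j = 0 from this]
  have hyI : y = I.primalSol v := by
    rw [← hysum]
    exact I.eq_primalSol fun j hj => by_contra fun h => hj ((hmem j).2 (hyB h))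
  refine ⟨I, ?_, ?_⟩
  · rw [LPBasis.DualFeasible, ← hw, ← hws]
    exact le_add_of_nonneg_right hs
  · rw [LPBasis.PrimalFeasible, ← hyI]
    exact hy

end StochLP

/-! ### Pivoting, uniqueness of optima and stability under perturbation. -/

namespace StochLP

variable {m d : ℕ} {A : Matrix (Fin m) (Fin d) ℝ}

namespace LPBasis

/-- **Pivoting**: if a dual constraint outside an optimal basis is tight and the program has only
one solution, then there is another optimal basis with the same dual solution. -/
theorem exists_ne_dualSol_eq {I : LPBasis A} {c : Fin d → ℝ} {v : Fin m → ℝ}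
    (hd : I.DualFeasible c) (hp : I.PrimalFeasible v) (huniq : (optSet A c v).Subsingleton)
    {j : Fin d} (hj : j ∉ I.idx) (htight : (I.dualSol c ᵥ* A) j = c j) :
    ∃ J : LPBasis A, J ≠ I ∧ J.dualSol c = I.dualSol c ∧ J.DualFeasible c ∧
      J.PrimalFeasible v := by
  classical
  let x := I.primalSol v
  -- The edge direction that raises coordinate `j` and corrects the basic ones to keep the
  -- right-hand side; its cost is the reduced cost at `j`, which is zero.
  let z : Fin d → ℝ := Pi.single j 1 - I.primalSol (A *ᵥ Pi.single j 1)
  have hAz : A *ᵥ z = 0 := by rw [Matrix.mulVec_sub, mulVec_primalSol, sub_self]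
  have hzj : z j = 1 := by simp [z, I.primalSol_of_notMem _ hj]
  have hz0 : ∀ k, k ∉ I.idx → k ≠ j → z k = 0 := fun k hk hkj => by
    simp [z, I.primalSol_of_notMem _ hk, hkj]
  have hcz : c ⬝ᵥ z = 0 := by
    rw [I.dotProduct_eq_add_reduced c z, hAz, dotProduct_zero, zero_add]
    refine Finset.sum_eq_zero fun k _ => ?_
    by_cases hk : k ∈ I.idx
    · simp [I.dualSol_vecMul_of_mem c hk]
    · by_cases hkj : k = j
      · simp [hkj, htight]
      · simp [hz0 k hk hkj]
  have hxopt : x ∈ optSet A c v := primalSol_mem_optSet hd hp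
  -- Otherwise `x + z` would be a second optimal solution.
  have hneg : ∃ i, z i < 0 := by
    by_contra! hz
    have hxz : x + z ∈ optSet A c v :=
      ⟨⟨by rw [Matrix.mulVec_add, hAz, add_zero, hxopt.1.1], add_nonneg hp hz⟩, fun y hy => by
        rw [dotProduct_add, hcz, add_zero]
        exact hxopt.2 y hy⟩
    have := congrFun (huniq hxz hxopt) j
    simp [hzj] at this
  obtain ⟨i₀, hi₀⟩ := hneg
  -- Ratio test: `i` is a coordinate that first reaches zero along `z`. A degenerate step of length
  -- zero is allowed, since only the basis has to change.
  obtain ⟨i, hi, hmin⟩ := Finset.exists_min_image (Finset.univ.filter fun i => z i < 0)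
    (fun i => x i / -z i) ⟨i₀, by simpa using hi₀⟩
  have hzi : z i < 0 := by simpa using hi
  have hij : i ≠ j := by
    rintro rfl
    linarith
  have hiI : i ∈ I.idx := by
    by_contra h
    exact hzi.ne (hz0 i h hij)
  let t := x i / -z i
  have ht : 0 ≤ t := div_nonneg (hp i) (neg_nonneg.2 hzi.le)
  let y := x + t • z
  have hy : 0 ≤ y := fun k => by
    change 0 ≤ x k + t * z k
    rcases le_or_gt 0 (z k) with h | h
    · exact add_nonneg (hp k) (mul_nonneg ht h)
    · have h₁ : t ≤ x k / -z k := hmin k (by simpa using h)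
      rw [le_div_iff₀ (neg_pos.2 h)] at h₁
      linarith
  have hyi : y i = 0 := by
    change x i + x i / -z i * z i = 0
    field_simp [hzi.ne]
    ring
  have hAy : A *ᵥ y = v := by
    rw [Matrix.mulVec_add, Matrix.mulVec_smul, hAz, smul_zero, add_zero, hxopt.1.1]
  have hjer : j ∉ I.idx.erase i := fun h => hj (Finset.mem_of_mem_erase h)
  have hcard : (insert j (I.idx.erase i)).card = m := by
    rw [Finset.card_insert_of_notMem hjer, Finset.card_erase_of_mem hiI, I.card_idx]
    have := Finset.card_pos.2 ⟨i, hiI⟩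
    rw [I.card_idx] at this
    omega
  let J : LPBasis A := ofKernelTrivial (insert j (I.idx.erase i)) hcard fun g hg hAg => by
    -- Subtracting `g j • z` clears coordinate `j` and leaves a kernel vector supported in `I`,
    -- hence zero. Coordinate `i`, where `z i ≠ 0`, then forces `g j = 0`.
    have h₁ := I.eq_primalSol (y := g - g j • z) fun k hk => by
      by_cases hkj : k = j
      · simp [hkj, hzj]
      · have : g k = 0 := hg k (by simp [hkj, hk])
        simp [this, hz0 k hk hkj]
    have h₂ : I.primalSol (0 : Fin m → ℝ) = 0 := by
      have := I.eq_primalSol (y := 0) fun _ _ => rfl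
      rw [Matrix.mulVec_zero] at this
      exact this.symm
    rw [Matrix.mulVec_sub, Matrix.mulVec_smul, hAg, hAz, smul_zero, sub_zero, h₂] at h₁
    have h₃ : g = g j • z := sub_eq_zero.1 h₁
    have h₄ : g i = 0 := hg i (by simp [hij])
    have h₅ : g j * z i = 0 := by rw [← h₄]; exact (congrFun h₃ i).symm
    have h₆ : g j = 0 := (mul_eq_zero.1 h₅).resolve_right hzi.ne
    rw [h₃, h₆, zero_smul]
  have hJ : ∀ k, k ∈ J.idx ↔ k = j ∨ k ≠ i ∧ k ∈ I.idx := fun k => by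
    simp [J, ofKernelTrivial]
  have hdual : I.dualSol c = J.dualSol c := J.eq_dualSol fun k hk => by
    rcases (hJ k).1 hk with rfl | h
    · exact htight
    · exact I.dualSol_vecMul_of_mem c h.2
  have hyJ : y = J.primalSol v := by
    rw [← hAy]
    refine J.eq_primalSol fun k hk => ?_
    rw [hJ] at hk
    push Not at hk
    by_cases hki : k = i
    · rw [hki, hyi]
    · have hkI := hk.2 hki
      have : z k = 0 := hz0 k hkI hk.1
      simp [y, x, I.primalSol_of_notMem v hkI, this]
  refine ⟨J, fun h => hj ?_, hdual.symm, ?_, ?_⟩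
  · rw [← h, hJ]
    exact Or.inl rfl
  · rw [DualFeasible, ← hdual]
    exact hd
  · rw [PrimalFeasible, ← hyJ]
    exact hy

/-- If all reduced costs outside a primal feasible basis are positive, the basic solution is the
only optimal one. -/
theorem optSet_eq_singleton {I : LPBasis A} {c : Fin d → ℝ} {v : Fin m → ℝ}
    (hd : I.DualFeasible c) (hstrict : ∀ j, j ∉ I.idx → (I.dualSol c ᵥ* A) j ≠ c j)
    (hp : I.PrimalFeasible v) : optSet A c v = {I.primalSol v} := by
  refine Set.eq_singleton_iff_unique_mem.2 ⟨primalSol_mem_optSet hd hp, fun y hy => ?_⟩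
  have hle := hy.2 _ (primalSol_mem_optSet hd hp).1
  rw [I.dotProduct_eq_add_reduced c y, I.dotProduct_eq_add_reduced c (I.primalSol v), hy.1.1,
    mulVec_primalSol, reduced_dotProduct_primalSol, add_zero, add_le_iff_nonpos_right] at hle
  have hnn : ∀ j ∈ Finset.univ, 0 ≤ (c - I.dualSol c ᵥ* A) j * y j := fun j _ =>
    mul_nonneg (sub_nonneg.2 (hd j)) (hy.1.2 j)
  -- Equal cost forces every product of reduced cost and coordinate to vanish.
  have h0 := (Finset.sum_eq_zero_iff_of_nonneg hnn).1 (le_antisymm hle (Finset.sum_nonneg hnn))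
  rw [← hy.1.1]
  refine I.eq_primalSol fun j hj => (mul_eq_zero.1 (h0 j (Finset.mem_univ j))).resolve_left ?_
  exact sub_ne_zero.2 (hstrict j hj).symm

theorem isClosed_setOf_primalFeasible (I : LPBasis A) : IsClosed {v | I.PrimalFeasible v} :=
  isClosed_Ici.preimage I.continuous_primalSol

end LPBasis

/-- Only bases that are feasible for `b` are feasible for right-hand sides close to `b`. -/
theorem eventually_primalFeasible_imp (A : Matrix (Fin m) (Fin d) ℝ) (b : Fin m → ℝ) :
    ∀ᶠ v in 𝓝 b, ∀ J : LPBasis A, J.PrimalFeasible v → J.PrimalFeasible b := by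
  refine eventually_all.2 fun J => ?_
  by_cases h : J.PrimalFeasible b
  · exact Eventually.of_forall fun _ _ => h
  · filter_upwards [J.isClosed_setOf_primalFeasible.isOpen_compl.mem_nhds h] with v hv hv'
    exact absurd hv' hv

/-- By the fundamental theorem this is a finite union of closed sets. It makes the solvability event
null-measurable, so that its complement has probability tending to zero. -/
theorem isClosed_setOf_optSet_nonempty (hA : A.rank = m) (c : Fin d → ℝ) :
    IsClosed {v | (optSet A c v).Nonempty} := by
  have : {v | (optSet A c v).Nonempty} =
      ⋃ J ∈ {J : LPBasis A | J.DualFeasible c}, {v | J.PrimalFeasible v} := by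
    ext v
    simp only [Set.mem_ofPred_eq, Set.mem_iUnion, exists_prop]
    exact ⟨exists_dualFeasible_primalFeasible hA,
      fun ⟨J, hd, hp⟩ => ⟨_, LPBasis.primalSol_mem_optSet hd hp⟩⟩
  rw [this]
  exact Set.Finite.isClosed_biUnion (Set.toFinite _) fun J _ => J.isClosed_setOf_primalFeasible

/-! ### Directional behaviour of the optimal solution at `b`. -/

section Perturbation

variable {m₀ : ℕ}

theorem continuous_glue_zero : Continuous fun v : Fin m₀ → ℝ => glue v (0 : Fin m → ℝ) := by
  refine continuous_pi fun i => ?_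
  unfold glue
  by_cases h : i.1 < m₀
  · simp only [h, dite_true]
    exact continuous_apply _
  · simp only [h, dite_false]
    exact continuous_const

theorem glue_eq_add_smul (hm₀ : m₀ ≤ m) (b : Fin m → ℝ) (u : Fin m₀ → ℝ) {r : ℝ} (hr : r ≠ 0) :
    glue u b = b + r⁻¹ • glue (r • (u - head hm₀ b)) 0 := by
  ext i
  by_cases h : i.1 < m₀
  · simp [glue, h, head, hr]
  · simp [glue, h]

theorem isClosed_cone (I : LPBasis A) (xstar : Fin d → ℝ) : IsClosed (cone m₀ I xstar) := by
  simp only [cone, Set.ofPred_forall]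
  refine isClosed_iInter fun i => isClosed_iInter fun _ => isClosed_iInter fun _ => ?_
  exact isClosed_Ici.preimage ((continuous_apply i).comp
    (I.continuous_primalSol.comp continuous_glue_zero))

/-- The directional map of the optimal solution: on each cone it agrees with a basic solution, the
cone of least index having priority. -/
noncomputable def directionalSol {K : ℕ} (m₀ : ℕ) (I : Fin K → LPBasis A) (xstar : Fin d → ℝ)
    (v : Fin m₀ → ℝ) : Fin d → ℝ :=
  ∑ k : Fin K, (cone m₀ (I k) xstar \ ⋃ j : Fin K, ⋃ _ : j < k, cone m₀ (I j) xstar).indicator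
    (fun v => (I k).primalSol (glue v 0)) v

theorem measurable_directionalSol {K : ℕ} (I : Fin K → LPBasis A) (xstar : Fin d → ℝ) :
    Measurable (directionalSol m₀ I xstar) := by
  unfold directionalSol
  refine Finset.measurable_fun_sum _ fun k _ => ?_
  refine ((I k).continuous_primalSol.comp continuous_glue_zero).measurable.indicator ?_
  exact (isClosed_cone _ _).measurableSet.diff (MeasurableSet.iUnion fun j =>
    MeasurableSet.iUnion fun _ => (isClosed_cone _ _).measurableSet)

theorem exists_directionalSol_eq {K : ℕ} (I : Fin K → LPBasis A) (xstar : Fin d → ℝ)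
    {v : Fin m₀ → ℝ} (hv : ∃ k, v ∈ cone m₀ (I k) xstar) :
    ∃ k, v ∈ cone m₀ (I k) xstar ∧
      directionalSol m₀ I xstar v = (I k).primalSol (glue v 0) := by
  classical
  obtain ⟨k, hk, hmin⟩ := Finset.exists_min_image
    (Finset.univ.filter fun k => v ∈ cone m₀ (I k) xstar) id
    (by obtain ⟨k, hk⟩ := hv; exact ⟨k, by simpa using hk⟩)
  have hk' : v ∈ cone m₀ (I k) xstar := by simpa using hk
  have hmin' : ∀ j, v ∈ cone m₀ (I j) xstar → k ≤ j := fun j hj => hmin j (by simpa using hj)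
  refine ⟨k, hk', ?_⟩
  unfold directionalSol
  rw [Finset.sum_eq_single k]
  · refine Set.indicator_of_mem (Set.mem_sdiff_of_mem hk' ?_) _
    simp only [Set.mem_iUnion, not_exists]
    exact fun j hj hvj => (hmin' j hvj).not_gt hj
  · intro l _ hlk
    refine Set.indicator_of_notMem ?_ _
    rintro ⟨hl, hl'⟩
    simp only [Set.mem_iUnion, not_exists] at hl'
    exact hl' k (lt_of_le_of_ne (hmin' l hl) (Ne.symm hlk)) hk'
  · simp

/-- Basic solutions of two strictly dual feasible optimal bases agree on the common part of their
cones. -/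
theorem primalSol_eq_of_mem_cone {I J : LPBasis A} {c : Fin d → ℝ} {b : Fin m → ℝ}
    {xstar : Fin d → ℝ} (hx : 0 ≤ xstar)
    (hI : ∀ v, I.PrimalFeasible v → optSet A c v = {I.primalSol v})
    (hJ : ∀ v, J.PrimalFeasible v → optSet A c v = {J.primalSol v})
    (hIb : I.primalSol b = xstar) (hJb : J.primalSol b = xstar) {v : Fin m₀ → ℝ}
    (hvI : v ∈ cone m₀ I xstar) (hvJ : v ∈ cone m₀ J xstar) :
    I.primalSol (glue v 0) = J.primalSol (glue v 0) := by
  -- The cone constrains only coordinates where `xstar` vanishes; the others stay positive for small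
  -- `ε`. So both bases are feasible at a common `b + ε • glue v 0`, where the optimum is unique.
  have key : ∀ L : LPBasis A, L.primalSol b = xstar → v ∈ cone m₀ L xstar →
      ∀ᶠ ε in 𝓝[>] (0 : ℝ), L.PrimalFeasible (b + ε • glue v 0) := fun L hLb hvL => by
    filter_upwards [eventually_forall_nonneg_add_mul (y := L.primalSol (glue v 0)) hx
      fun i hi => by
        by_cases hiL : i ∈ L.idx
        · exact hvL i hiL hi
        · rw [L.primalSol_of_notMem _ hiL]] with ε hε
    rw [LPBasis.PrimalFeasible, L.primalSol_add_smul, hLb]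
    exact hε
  obtain ⟨ε, ⟨h₁, h₂⟩, hε⟩ :=
    (((key I hIb hvI).and (key J hJb hvJ)).and self_mem_nhdsWithin).exists
  have h := Set.singleton_injective ((hI _ h₁).symm.trans (hJ _ h₂))
  rw [I.primalSol_add_smul, J.primalSol_add_smul, hIb, hJb] at h
  exact smul_right_injective _ (ne_of_gt hε) (add_left_cancel h)

end Perturbation

end StochLP

/-! ### Portmanteau, continuous mapping on a closed set, and tightness. -/

section ConvergenceInDistribution

variable {ι E F Ω' : Type*} {Ω : ι → Type*} [∀ i, MeasurableSpace (Ω i)]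
  {P : (i : ι) → Measure (Ω i)} [∀ i, IsProbabilityMeasure (P i)]
  [MeasurableSpace Ω'] {P' : Measure Ω'} [IsProbabilityMeasure P']
  [MeasurableSpace E] {X : (i : ι) → Ω i → E} {Z : Ω' → E} {l : Filter ι}

theorem MeasureTheory.TendstoInDistribution.limsup_measure_le [TopologicalSpace E] [OpensMeasurableSpace E]
    [HasOuterApproxClosed E] (h : TendstoInDistribution X l Z P P') {C : Set E}
    (hC : IsClosed C) : l.limsup (fun i => P i (X i ⁻¹' C)) ≤ P' (Z ⁻¹' C) := by
  have := ProbabilityMeasure.limsup_measure_closed_le_of_tendsto h.tendsto hC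
  simp only [ProbabilityMeasure.coe_mk] at this
  rw [Measure.map_apply_of_aemeasurable h.aemeasurable_limit hC.measurableSet] at this
  simpa only [Measure.map_apply_of_aemeasurable (h.forall_aemeasurable _) hC.measurableSet]
    using this

/-- A variant of the continuous mapping theorem: the map need only be continuous on a closed set
which carries the variables with probability tending to one, and the image variables may be
changed with probability tending to zero. -/
theorem MeasureTheory.TendstoInDistribution.comp_continuousOn [TopologicalSpace E] [OpensMeasurableSpace E]
    [HasOuterApproxClosed E] [TopologicalSpace F] [MeasurableSpace F] [BorelSpace F]
    [HasOuterApproxClosed F] [l.IsCountablyGenerated]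
    (h : TendstoInDistribution X l Z P P') {H : Set E} (hH : IsClosed H) {g : E → F}
    (hg : ContinuousOn g H) (hgm : Measurable g) {Y : (i : ι) → Ω i → F}
    (hY : ∀ i, AEMeasurable (Y i) (P i))
    (hbad : Tendsto (fun i => P i {ω | ¬ (X i ω ∈ H ∧ Y i ω = g (X i ω))}) l (𝓝 0)) :
    TendstoInDistribution Y l (fun ω => g (Z ω)) P P' where
  forall_aemeasurable := hY
  aemeasurable_limit := hgm.comp_aemeasurable h.aemeasurable_limit
  tendsto := by
    refine tendsto_of_forall_isClosed_limsup_le' fun C hC => ?_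
    have hZ : AEMeasurable (fun ω => g (Z ω)) P' := hgm.comp_aemeasurable h.aemeasurable_limit
    simp only [ProbabilityMeasure.coe_mk]
    rw [Measure.map_apply_of_aemeasurable hZ hC.measurableSet]
    simp only [Measure.map_apply_of_aemeasurable (hY _) hC.measurableSet]
    calc l.limsup (fun i => P i (Y i ⁻¹' C))
        ≤ l.limsup (fun i => P i (X i ⁻¹' (H ∩ g ⁻¹' C)) +
            P i {ω | ¬ (X i ω ∈ H ∧ Y i ω = g (X i ω))}) := by
          refine limsup_le_limsup (Eventually.of_forall fun i => ?_)
          refine (measure_mono fun ω hω => ?_).trans (measure_union_le _ _)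
          by_cases hc : X i ω ∈ H ∧ Y i ω = g (X i ω)
          · exact Or.inl ⟨hc.1, by rw [Set.mem_preimage, ← hc.2]; exact hω⟩
          · exact Or.inr hc
      _ = l.limsup (fun i => P i (X i ⁻¹' (H ∩ g ⁻¹' C))) :=
          ENNReal.limsup_add_of_right_tendsto_zero hbad _
      _ ≤ P' (Z ⁻¹' (H ∩ g ⁻¹' C)) :=
          -- Continuity of `g` on the closed set `H` is just enough to make `H ∩ g ⁻¹' C` closed;
          -- the next bound drops `H`, so that `Z ∈ H` need not be shown separately.
          h.limsup_measure_le (hg.preimage_isClosed_of_isClosed hH hC)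
      _ ≤ P' ((fun ω => g (Z ω)) ⁻¹' C) := measure_mono fun ω hω => hω.2

/-- A sequence that converges in distribution exceeds levels tending to infinity with probability
tending to zero. -/
theorem MeasureTheory.TendstoInDistribution.tendsto_measure_le_norm [NormedAddCommGroup E] [BorelSpace E]
    (h : TendstoInDistribution X l Z P P') {R : ι → ℝ} (hR : Tendsto R l atTop) :
    Tendsto (fun i => P i {ω | R i ≤ ‖X i ω‖}) l (𝓝 0) := by
  have hcl (k : ℕ) : IsClosed {x : E | (k : ℝ) ≤ ‖x‖} :=
    isClosed_le continuous_const continuous_norm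
  have htail : Tendsto (fun k : ℕ => P' (Z ⁻¹' {x | (k : ℝ) ≤ ‖x‖})) atTop (𝓝 0) := by
    have hanti : Antitone fun k : ℕ => Z ⁻¹' {x : E | (k : ℝ) ≤ ‖x‖} := fun k k' hk ω hω =>
      show (k : ℝ) ≤ ‖Z ω‖ from (Nat.cast_le.2 hk).trans hω
    have := tendsto_measure_iInter_atTop (μ := P')
      (fun k => h.aemeasurable_limit.nullMeasurableSet_preimage (hcl k).measurableSet) hanti
      ⟨0, measure_ne_top _ _⟩
    rwa [show ⋂ k : ℕ, Z ⁻¹' {x : E | (k : ℝ) ≤ ‖x‖} = ∅ from ?_, measure_empty] at this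
    ext ω
    obtain ⟨k, hk⟩ := exists_nat_gt ‖Z ω‖
    simp only [Set.mem_iInter, Set.mem_empty_iff_false, iff_false, not_forall]
    exact ⟨k, not_le.2 hk⟩
  refine ENNReal.tendsto_nhds_zero.2 fun ε hε => ?_
  -- One fixed level with small limiting tail suffices, as `R` eventually exceeds it.
  obtain ⟨k, hk⟩ := (htail.eventually (gt_mem_nhds hε)).exists
  have hlim := (h.limsup_measure_le (hcl k)).trans_lt hk
  filter_upwards [eventually_lt_of_limsup_lt hlim, hR.eventually_ge_atTop (k : ℝ)] with i hi hRi
  exact (measure_mono fun ω hω => hRi.trans hω).trans hi.le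

end ConvergenceInDistribution

/-! ### The limit theorem. -/

theorem theorem3p2 {m d m₀ : ℕ} (hm₀ : m₀ ≤ m)
    -- the linear program, with `A` of full rank `m`
    (A : Matrix (Fin m) (Fin d) ℝ) (hA : A.rank = m) (b : Fin m → ℝ) (c : Fin d → ℝ)
    -- (A2): existence and uniqueness of the optimal solution `x*(b)`
    (xstar : Fin d → ℝ) (hA2 : StochLP.optSet A c b = {xstar})
    -- an enumeration `I_1, …, I_K` of all bases that are both primal and dual feasible
    {K : ℕ} (I : Fin K → StochLP.LPBasis A) (hI_inj : Function.Injective I)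
    (hI_range : ∀ J : StochLP.LPBasis A,
      J ∈ Set.range I ↔ J.DualFeasible c ∧ J.PrimalFeasible b)
    -- (A3): the dual optimal basic solutions `λ(I_k)` are pairwise distinct
    (hA3 : ∀ j k : Fin K, j < k → (I j).dualSol c ≠ (I k).dualSol c)
    -- the probability spaces, the random part of `b_n`, and the limit
    {Ω : ℕ → Type*} [∀ n, MeasurableSpace (Ω n)]
    (P : (n : ℕ) → Measure (Ω n)) [∀ n, IsProbabilityMeasure (P n)]
    {Ω' : Type*} [MeasurableSpace Ω'] (P' : Measure Ω') [IsProbabilityMeasure P']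
    (bn : (n : ℕ) → Ω n → (Fin m₀ → ℝ)) (G : Ω' → (Fin m₀ → ℝ))
    (r : ℕ → ℝ) (hr : Tendsto r atTop atTop)
    -- (B1), without absolute continuity of the limit
    (hB1 : TendstoInDistribution (fun n ω => r n • (bn n ω - StochLP.head hm₀ b)) atTop G P P')
    -- (B2): asymptotically an empirical optimal solution exists
    (hB2 : Tendsto (fun n => P n {ω | (StochLP.optSet A c (StochLP.glue (bn n ω) b)).Nonempty})
      atTop (𝓝 1))
    -- any measurable choice of an empirical optimal solution
    (xn : (n : ℕ) → Ω n → (Fin d → ℝ)) (hxn_meas : ∀ n, AEMeasurable (xn n) (P n))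
    (hxn : ∀ n, ∀ᵐ ω ∂(P n), (StochLP.optSet A c (StochLP.glue (bn n ω) b)).Nonempty →
      xn n ω ∈ StochLP.optSet A c (StochLP.glue (bn n ω) b)) :
    TendstoInDistribution (fun n ω => r n • (xn n ω - xstar)) atTop
      (fun ω => ∑ k : Fin K,
        (StochLP.cone m₀ (I k) xstar \ ⋃ j : Fin K, ⋃ _ : j < k,
          StochLP.cone m₀ (I j) xstar).indicator
          (fun v => (I k).primalSol (StochLP.glue v 0)) (G ω)) P P' := by
  classical
  -- every optimal basis is strictly dual feasible
  have hfeas (k : Fin K) : (I k).DualFeasible c ∧ (I k).PrimalFeasible b :=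
    (hI_range (I k)).1 ⟨k, rfl⟩
  have huniq (k : Fin K) (v : Fin m → ℝ) (hv : (I k).PrimalFeasible v) :
      StochLP.optSet A c v = {(I k).primalSol v} := by
    refine StochLP.LPBasis.optSet_eq_singleton (hfeas k).1 (fun j hj htight => ?_) hv
    obtain ⟨J, hne, hdual, hJ⟩ := StochLP.LPBasis.exists_ne_dualSol_eq (hfeas k).1 (hfeas k).2
      (hA2 ▸ Set.subsingleton_singleton) hj htight
    obtain ⟨l, rfl⟩ := (hI_range J).2 hJ
    rcases lt_or_gt_of_ne (fun h : l = k => hne (congrArg I h)) with h | h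
    · exact hA3 l k h hdual
    · exact hA3 k l h hdual.symm
  have hxb (k : Fin K) : (I k).primalSol b = xstar :=
    Set.singleton_injective ((huniq k b (hfeas k).2).symm.trans hA2)
  have hx0 : 0 ≤ xstar := (hA2 ▸ Set.mem_singleton xstar : xstar ∈ StochLP.optSet A c b).1.2
  -- the directional map on the union of the cones
  let g : (Fin m₀ → ℝ) → Fin d → ℝ := StochLP.directionalSol m₀ I xstar
  have hg (k : Fin K) {v : Fin m₀ → ℝ} (hv : v ∈ StochLP.cone m₀ (I k) xstar) :
      g v = (I k).primalSol (StochLP.glue v 0) := by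
    obtain ⟨l, hl, hgl⟩ := StochLP.exists_directionalSol_eq I xstar ⟨k, hv⟩
    exact hgl.trans (StochLP.primalSol_eq_of_mem_cone hx0 (huniq l) (huniq k) (hxb l) (hxb k) hl hv)
  -- Pasting lemma for finitely many closed cones; by `hg` each basic solution gives `g` on its
  -- whole cone, not only on the part where it has priority.
  have hgcont : ContinuousOn g (⋃ k, StochLP.cone m₀ (I k) xstar) :=
    (locallyFinite_of_finite _).continuousOn_iUnion (fun k => StochLP.isClosed_cone _ _) fun k =>
      ((I k).continuous_primalSol.comp StochLP.continuous_glue_zero).continuousOn.congr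
        fun v hv => hg k hv
  have hHclosed : IsClosed (⋃ k, StochLP.cone m₀ (I k) xstar) :=
    isClosed_iUnion_of_finite fun k => StochLP.isClosed_cone _ _
  refine hB1.comp_continuousOn hHclosed hgcont (StochLP.measurable_directionalSol I xstar)
    (fun n => ((hxn_meas n).sub_const xstar).const_smul (r n)) ?_
  -- a neighbourhood of `b` in which only the bases `I k` matter
  have hnear : ∀ᶠ v in 𝓝 (0 : Fin m₀ → ℝ), ∀ J : StochLP.LPBasis A,
      J.PrimalFeasible (b + StochLP.glue v 0) → J.PrimalFeasible b := by
    have hcont : Continuous fun v : Fin m₀ → ℝ => b + StochLP.glue v (0 : Fin m → ℝ) :=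
      continuous_const.add StochLP.continuous_glue_zero
    have h0 : b + StochLP.glue (0 : Fin m₀ → ℝ) (0 : Fin m → ℝ) = b := by
      ext i
      simp [StochLP.glue]
    have := hcont.tendsto 0
    rw [h0] at this
    exact this.eventually (StochLP.eventually_primalFeasible_imp A b)
  obtain ⟨δ, hδ, hball⟩ := Metric.eventually_nhds_iff.1 hnear
  have hsolv : Tendsto
      (fun n => P n {ω | (StochLP.optSet A c (StochLP.glue (bn n ω) b)).Nonempty}ᶜ)
      atTop (𝓝 0) := by
    have h₁ := ENNReal.Tendsto.sub (tendsto_const_nhds (x := (1 : ENNReal))) hB2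
      (Or.inl ENNReal.one_ne_top)
    rw [tsub_self] at h₁
    refine h₁.congr' ?_
    filter_upwards [hr.eventually_gt_atTop 0] with n hn
    refine (prob_compl_eq_one_sub₀ ?_).symm
    have hcl : IsClosed {v : Fin m₀ → ℝ |
        (StochLP.optSet A c (b + (r n)⁻¹ • StochLP.glue v 0)).Nonempty} :=
      (StochLP.isClosed_setOf_optSet_nonempty hA c).preimage
        ((by fun_prop : Continuous fun w : Fin m → ℝ => b + (r n)⁻¹ • w).comp
          StochLP.continuous_glue_zero)
    have := (hB1.forall_aemeasurable n).nullMeasurableSet_preimage hcl.measurableSet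
    convert this using 1
    ext ω
    simp only [Set.mem_preimage, Set.mem_ofPred_eq]
    rw [← StochLP.glue_eq_add_smul hm₀ b (bn n ω) hn.ne']
  -- The threshold `r n * δ` is the scaled form of `bn n ω` lying at distance `δ` from the head of
  -- `b`.
  have hfar := hB1.tendsto_measure_le_norm (hr.atTop_mul_const hδ)
  have hsum := hsolv.add hfar
  rw [add_zero] at hsum
  refine tendsto_of_tendsto_of_tendsto_of_le_of_le' tendsto_const_nhds hsum
    (Eventually.of_forall fun n => zero_le) ?_
  filter_upwards [hr.eventually_gt_atTop 0] with n hn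
  -- Almost surely, off the events of insolvability and of a large deviation, the scaled error
  -- equals `g` of the scaled perturbation exactly.
  refine (measure_mono_ae ?_).trans (measure_union_le _ _)
  filter_upwards [hxn n] with ω hω hbad
  by_contra hgood
  obtain ⟨hne, hsmall⟩ := not_or.1 hgood
  replace hne := Set.notMem_compl_iff.1 hne
  replace hsmall : ‖r n • (bn n ω - StochLP.head hm₀ b)‖ < r n * δ :=
    lt_of_not_ge fun h => hsmall h
  refine hbad ?_
  have hmem := hω hne
  obtain ⟨J, hJd, hJp⟩ := StochLP.exists_dualFeasible_primalFeasible hA hne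
  have hglue := StochLP.glue_eq_add_smul hm₀ b (bn n ω) hn.ne'
  set v := r n • (bn n ω - StochLP.head hm₀ b) with hv
  have hJb : J.PrimalFeasible b := by
    refine hball (y := (r n)⁻¹ • v) ?_ J ?_
    · rw [dist_zero_right, norm_smul, norm_inv, Real.norm_of_nonneg hn.le, inv_mul_lt_iff₀ hn]
      exact hsmall
    · have hsm : StochLP.glue ((r n)⁻¹ • v) (0 : Fin m → ℝ) = (r n)⁻¹ • StochLP.glue v 0 := by
        ext i
        by_cases h : i.1 < m₀ <;> simp [StochLP.glue, h]
      rw [hsm, ← hglue]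
      exact hJp
  obtain ⟨k, rfl⟩ := (hI_range J).2 ⟨hJd, hJb⟩
  have hxk : xn n ω = xstar + (r n)⁻¹ • (I k).primalSol (StochLP.glue v 0) := by
    rw [huniq k _ hJp, Set.mem_singleton_iff, hglue, (I k).primalSol_add_smul, hxb] at hmem
    exact hmem
  -- Where `xstar i = 0`, the nonnegative coordinate of the perturbed solution is `(r n)⁻¹` times
  -- that of the direction.
  have hcone : v ∈ StochLP.cone m₀ (I k) xstar := fun i _ hi0 => by
    have h := hJp i
    rw [hglue, (I k).primalSol_add_smul, hxb] at h
    simp only [Pi.zero_apply, Pi.add_apply, hi0, zero_add, Pi.smul_apply, smul_eq_mul] at h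
    exact nonneg_of_mul_nonneg_right h (inv_pos.2 hn)
  refine ⟨Set.mem_iUnion.2 ⟨k, hcone⟩, ?_⟩
  rw [hg k hcone, hxk, add_sub_cancel_left, smul_inv_smul₀ hn.ne']
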